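/- Let $A=(a_{ij})\in\mathbb{R}^{m\times n}$ have nonnegative entries and be surjective as a map $\mathbb{R}^n\to\mathbb{R}^m$, let $b\in\mathbb{R}^m$ have positive entries, and let $\epsilon\ge 0$, $\mu>0$, $\delta>0$. With $0\log 0=0$, let $\phi(u)=\sum_i u_i\log u_i$ (equal to $+\infty$ outside the nonnegative orthant), $D_f(x,y)=f(x)-f(y)-\langle\nabla f(y),x-y\rangle$, and $$E(x)=D_\phi(Ax,b)+\tfrac{\epsilon}{2}\|Ax-b\|^2,\qquad h(x)=\sum_{i=1}^n x_i\log x_i+\tfrac{\epsilon}{2}\|x\|^2,\qquad \operatorname{dom}h=\mathbb{R}^n_{\ge0}.$$ Let $\mathcal X_0=\arg\min\{E(x):x\in\overline{\operatorname{dom}h}\}$. Say that (LC) holds with constant $L>0$ if $Lh-E$ is convex on $\operatorname{int}\operatorname{dom}h$, and let $\alpha(h)=\inf\{D_h(x,y)/D_h(y,x): x,y\in\operatorname{int}\operatorname{dom}h,\ x\neq y\}$ (with value $0$ if $n=0$). Consider the iteration $$x^{k+1}=\arg\min_{x}\Big\{\delta\mu\|x\|_1+\langle\overline p^k,x\rangle+\sum_{i=1}^n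 x_i\log x_i+\tfrac{\epsilon}{2}\|x\|^2\Big\},\qquad \overline p^k=\delta\nabla E(x^k)-\nabla h(x^k)-\delta\mu p^k,$$ $$p^{k+1}=p^k-\tfrac{1}{\delta\mu}\big[\nabla h(x^{k+1})-\nabla h(x^k)+\delta\nabla E(x^k)\big],$$ started either at $x^0=p^0=0$, where (for $n\geq 1$, since $0\notin\operatorname{int}\operatorname{dom}h$) the terms $\nabla h(x^0)$ and $\nabla E(x^0)$ are read as $0$, so that $x^1=\arg\min\{\delta\mu\|x\|_1+h(x)\}$; or at any $x^0\in\operatorname{int}\operatorname{dom}h$ and $p^0\in\mathbb{R}^n$ with $\nabla h(x^0)+\delta\mu p^0=0$. Then: 1. (LC) holds with every $L>0$ such that $L\ge\|A\|^2$ (spectral norm) and $L\ge\sum_{i=1}^m a_{ij}$ for all $j$. 2. For every $q\in\mathbb{R}^n$ the function $\delta\mu\|x\|_1+\langle q,x\rangle+\sum_i x_i\log x_i+\frac{\epsilon}{2}\|x\|^2$ has a unique minimizer over $\operatorname{dom}h$, and it lies in $\operatorname{int}\operatorname{dom}h$; so the iteration is well defined. 3. The problem $\min\{\mu\|x\|_1+\frac{\epsilon}{2\delta}\|x\|^2+\frac1\delta\sum_{i=1}^n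 x_i\log x_i:\ x\in\mathcal X_0\}$ has a unique minimizer $\hat x$. If (LC) holds with a constant $L>0$ and $\delta<\frac{1+\alpha(h)-\omega}{L}$ for some $\omega\in(0,1+\alpha(h))$, then every sequence $\{x^k\}$ so generated converges either to $\hat x$ or to a boundary point of $\operatorname{dom}h$. -/

import Mathlib

noncomputable section

namespace LBreg

/-- `ℝⁿ` with the Euclidean norm and inner product. -/
abbrev Vec (n : ℕ) : Type := EuclideanSpace ℝ (Fin n)

/-- The linear operator `x ↦ A x` between Euclidean spaces; its norm is the spectral norm. -/
def linOp {m n : ℕ} (A : Matrix (Fin m) (Fin n) ℝ) : Vec n →L[ℝ] Vec m :=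
  LinearMap.toContinuousLinearMap (Matrix.toEuclideanLin A)

/-- The nonnegative orthant. It is the effective domain of the Boltzmann-Shannon entropy and of
`relFun` below, both of which are `+∞` outside of it. -/
def orthant (n : ℕ) : Set (Vec n) := {x | ∀ i, 0 ≤ x i}

/-- The (finite) values on the orthant of the Boltzmann-Shannon entropy `∑ xᵢ log xᵢ`, where
`0 log 0 = 0`. -/
def entropy {n : ℕ} (x : Vec n) : ℝ := ∑ i, x i * Real.log (x i)

/-- The `ℓ¹` norm. -/
def l1 {n : ℕ} (x : Vec n) : ℝ := ∑ i, |x i|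

/-- The Bregman distance `D_f(x, y) = f(x) - f(y) - ⟨∇f(y), x - y⟩` (used only for `y` at which
`f` is differentiable). -/
def bregman {n : ℕ} (f : Vec n → ℝ) (x y : Vec n) : ℝ :=
  f x - f y - inner ℝ (gradient f y) (x - y)

/-- The relative function `h(x) = ∑ xᵢ log xᵢ + (ε/2) ‖x‖²` on its domain, the orthant. -/
def relFun {n : ℕ} (ε : ℝ) (x : Vec n) : ℝ := entropy x + ε / 2 * ‖x‖ ^ 2

/-- The energy `E(x) = D_φ(Ax, b) + (ε/2) ‖Ax - b‖²`, with `φ` the Boltzmann-Shannon entropy. -/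
def energy {m n : ℕ} (A : Matrix (Fin m) (Fin n) ℝ) (b : Vec m) (ε : ℝ) (x : Vec n) : ℝ :=
  bregman entropy (linOp A x) b + ε / 2 * ‖linOp A x - b‖ ^ 2

/-- The Lipschitz-like convexity condition with constant `L`: the function `L h - E` is convex on
the interior of `dom h`. -/
def LipschitzLike {m n : ℕ} (A : Matrix (Fin m) (Fin n) ℝ) (b : Vec m) (ε L : ℝ) : Prop :=
  ConvexOn ℝ (interior (orthant n)) (fun x => L * relFun ε x - energy A b ε x)

/-- The symmetry coefficient `α(h) = inf { D_h(x,y) / D_h(y,x) : x ≠ y in int dom h }`. -/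
def symCoeff (n : ℕ) (ε : ℝ) : ℝ :=
  sInf {r | ∃ x ∈ interior (orthant n), ∃ y ∈ interior (orthant n),
    x ≠ y ∧ r = bregman (relFun ε) x y / bregman (relFun ε) y x}

/-- The minimizers of `E` over the closure of `dom h`. -/
def X0 {m n : ℕ} (A : Matrix (Fin m) (Fin n) ℝ) (b : Vec m) (ε : ℝ) : Set (Vec n) :=
  {x | x ∈ closure (orthant n) ∧ ∀ z ∈ closure (orthant n), energy A b ε x ≤ energy A b ε z}

/-- `μ ‖x‖₁ + (ε/(2δ)) ‖x‖² + (1/δ) ∑ xᵢ log xᵢ`. -/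
def regObj {n : ℕ} (ε μ δ : ℝ) (x : Vec n) : ℝ :=
  μ * l1 x + ε / (2 * δ) * ‖x‖ ^ 2 + 1 / δ * entropy x

/-- The gradient at the interior points of the orthant. At the other points, where the functions
under consideration have no gradient, a gradient term is by convention omitted (read as `0`);
the iteration can meet such a point only as its starting point. -/
def intGrad {n : ℕ} (f : Vec n → ℝ) (x : Vec n) : Vec n :=
  open Classical in if x ∈ interior (orthant n) then gradient f x else 0

/-- The objective `δ μ ‖x‖₁ + ⟨q, x⟩ + ∑ xᵢ log xᵢ + (ε/2) ‖x‖²` of a subproblem, on its domain,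
the orthant. -/
def subObj {n : ℕ} (ε μ δ : ℝ) (q x : Vec n) : ℝ :=
  δ * μ * l1 x + inner ℝ q x + entropy x + ε / 2 * ‖x‖ ^ 2

/-- The vector `δ ∇E(xᵏ) - ∇h(xᵏ) - δ μ pᵏ` of the linear term of a subproblem. -/
def pbar {m n : ℕ} (A : Matrix (Fin m) (Fin n) ℝ) (b : Vec m) (ε μ δ : ℝ) (x p : Vec n) : Vec n :=
  δ • intGrad (energy A b ε) x - intGrad (relFun ε) x - (δ * μ) • p

/-- The sequences `x`, `p` are produced by the iteration: `xᵏ⁺¹` minimizes the subproblem over the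
orthant, and `pᵏ⁺¹ = pᵏ - (1/(δμ)) (∇h(xᵏ⁺¹) - ∇h(xᵏ) + δ ∇E(xᵏ))`. -/
def IsGenerated {m n : ℕ} (A : Matrix (Fin m) (Fin n) ℝ) (b : Vec m) (ε μ δ : ℝ)
    (x p : ℕ → Vec n) : Prop :=
  ∀ k, (x (k + 1) ∈ orthant n ∧ ∀ z ∈ orthant n,
      subObj ε μ δ (pbar A b ε μ δ (x k) (p k)) (x (k + 1))
        ≤ subObj ε μ δ (pbar A b ε μ δ (x k) (p k)) z) ∧
    p (k + 1) = p k - (1 / (δ * μ)) •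
      (intGrad (relFun ε) (x (k + 1)) - intGrad (relFun ε) (x k)
        + δ • intGrad (energy A b ε) (x k))

/-- Admissible starts. Either `x⁰ = p⁰ = 0` (so that, by the convention in `intGrad`, the first
subproblem is to minimize `δ μ ‖x‖₁ + h(x)`), or `x⁰` is interior and the initial dual
variable `∇h(x⁰) + δ μ p⁰` vanishes. -/
def IsStart {n : ℕ} (ε μ δ : ℝ) (x₀ p₀ : Vec n) : Prop :=
  (x₀ = 0 ∧ p₀ = 0) ∨
    (x₀ ∈ interior (orthant n) ∧ gradient (relFun ε) x₀ + (δ * μ) • p₀ = 0)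

end LBreg

end

/-!
Let `D` be the Bregman distance of `h`. The energy is `E x = D (A x) b`, and the Bregman distance
of `E` is `D (A u) (A x)`. Hence (LC) with constant `L` says exactly that `D (A u) (A x) ≤ L D u x`;
this follows from Jensen's inequality for the Kullback-Leibler part of `D` and from the bound on
`‖A‖` for the quadratic part.

The vector `∇h (x k) + δ μ p k` starts at `0` and moves by `-δ ∇E (x k)`, so it stays in the range
of the adjoint of `A`, and by the optimality condition of the subproblems it equals
`∇h (x k) + δ μ (1, …, 1)` from `k = 1` on. From there on, the iteration is therefore mirror descent
for `E` in the geometry of `h`. As `α(h) ≤ 0`, the bound on the step size gives `δ L ≤ 1`. By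
the three-point identity of `D`, this makes `D u (x k)` decrease for every minimizer `u` of `E`
(Fejér monotonicity), and `x k` converges to a minimizer of `E`. If the limit is interior, then
`∇h + δ μ (1, …, 1)` at the limit is in the range of the adjoint, that is, orthogonal to the
differences of minimizers of `E`. This is the optimality condition of the regularized problem.
-/

noncomputable section

namespace LBreg

open Filter Topology InformationTheory InnerProductSpace

/-! ### Convexity -/

theorem convexOn_iff_add_inner_le {E : Type*} [NormedAddCommGroup E] [InnerProductSpace ℝ E]
    [CompleteSpace E] {s : Set E} {f : E → ℝ} {g : E → E} (hs : Convex ℝ s)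
    (hg : ∀ x ∈ s, HasGradientAt f (g x) x) :
    ConvexOn ℝ s f ↔ ∀ x ∈ s, ∀ y ∈ s, f x + inner ℝ (g x) (y - x) ≤ f y := by
  constructor
  · intro hf x hx y hy
    have hline : ConvexOn ℝ (AffineMap.lineMap x y ⁻¹' s) (f ∘ AffineMap.lineMap (k := ℝ) x y) :=
      hf.comp_affineMap _
    have hfderiv : HasFDerivAt f (toDual ℝ E (g x)) (AffineMap.lineMap x y (0 : ℝ)) := by
      simpa using (hg x hx).hasFDerivAt
    have hslope := hline.le_slope_of_hasDerivAt (x := 0) (y := 1) (by simpa using hx)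
      (by simpa using hy) zero_lt_one
      (hfderiv.comp_hasDerivAt 0 AffineMap.hasDerivAt_lineMap)
    simp only [toDual_apply_apply, slope_def_field, Function.comp_apply,
      AffineMap.lineMap_apply_one, AffineMap.lineMap_apply_zero, sub_zero, div_one] at hslope
    linarith
  · intro h
    refine ⟨hs, fun x hx y hy a c ha hc hac => ?_⟩
    have hz := hs hx hy ha hc hac
    set z := a • x + c • y
    have hcombo : a • (x - z) + c • (y - z) = 0 := by
      rw [smul_sub, smul_sub, sub_add_sub_comm, ← add_smul, hac, one_smul, sub_self]
    have hinner := congrArg (inner ℝ (g z)) hcombo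
    rw [inner_add_right, real_inner_smul_right, real_inner_smul_right, inner_zero_right] at hinner
    have hfx := mul_le_mul_of_nonneg_left (h z hz x hx) ha
    have hfy := mul_le_mul_of_nonneg_left (h z hz y hy) hc
    have hfz : f z = a * f z + c * f z := by rw [← add_mul, hac, one_mul]
    simp only [smul_eq_mul]
    linarith

/-! ### The orthant -/

section Orthant

variable {n : ℕ}

theorem inner_eq_sum (x y : Vec n) : inner ℝ x y = ∑ i, x i * y i := by
  simp [PiLp.inner_apply, mul_comm]

theorem isClosed_orthant (n : ℕ) : IsClosed (orthant n) := by
  rw [orthant, Set.ofPred_forall]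
  exact isClosed_iInter fun i => isClosed_le continuous_const (by fun_prop)

theorem closure_orthant (n : ℕ) : closure (orthant n) = orthant n :=
  (isClosed_orthant n).closure_eq

theorem convex_orthant (n : ℕ) : Convex ℝ (orthant n) := fun _ hx _ hy _ _ ha hc _ i =>
  add_nonneg (mul_nonneg ha (hx i)) (mul_nonneg hc (hy i))

theorem mem_interior_orthant {x : Vec n} : x ∈ interior (orthant n) ↔ ∀ i, 0 < x i := by
  have hpi : orthant n
      = PiLp.homeomorph 2 (fun _ : Fin n => ℝ) ⁻¹' Set.univ.pi fun _ => Set.Ici 0 := by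
    ext x
    simp [orthant, PiLp.homeomorph, Pi.le_def]
  rw [hpi, ← Homeomorph.preimage_interior, interior_pi_set Set.finite_univ]
  simp [PiLp.homeomorph]

theorem mem_orthant_of_pos {x : Vec n} (hx : ∀ i, 0 < x i) : x ∈ orthant n :=
  fun i => (hx i).le

/-- The vector `(1, …, 1)`. On the orthant the `ℓ¹` norm is the inner product with it. -/
def ones (n : ℕ) : Vec n := WithLp.toLp 2 fun _ => 1

theorem l1_eq_inner_ones {x : Vec n} (hx : x ∈ orthant n) : l1 x = inner ℝ (ones n) x := by
  rw [inner_eq_sum, l1]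
  exact Finset.sum_congr rfl fun i _ => by rw [abs_of_nonneg (hx i), ones, one_mul]

/-- The box of the nonnegative vectors bounded by `r`: the compact set in which minimizers and
limits are found. -/
def box (r : Fin n → ℝ) : Set (Vec n) := {x | ∀ i, x i ∈ Set.Icc 0 (r i)}

theorem isCompact_box (r : Fin n → ℝ) : IsCompact (box r) := by
  have hpi : box r = PiLp.homeomorph 2 (fun _ : Fin n => ℝ) ⁻¹'
      Set.univ.pi fun i => Set.Icc 0 (r i) := by
    ext x
    simp [box, PiLp.homeomorph, Pi.le_def, forall_and]
  rw [hpi, Homeomorph.isCompact_preimage]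
  exact isCompact_univ_pi fun _ => isCompact_Icc

theorem tendsto_of_tendsto_apply {ι : Type*} {l : Filter ι} {x : ι → Vec n} {a : Vec n}
    (h : ∀ i, Tendsto (fun k => x k i) l (𝓝 (a i))) : Tendsto x l (𝓝 a) :=
  ((PiLp.continuous_toLp 2 fun _ : Fin n => ℝ).tendsto a.ofLp).comp (tendsto_pi_nhds.2 h)

theorem hasGradientAt_sum_apply {f : Fin n → ℝ → ℝ} {f' : Fin n → ℝ} {x : Vec n}
    (h : ∀ i, HasDerivAt (f i) (f' i) (x i)) :
    HasGradientAt (fun y : Vec n => ∑ i, f i (y i)) (WithLp.toLp 2 f') x := by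
  have hcoord (i : Fin n) : HasFDerivAt (fun y : Vec n => f i (y i))
      (f' i • (PiLp.proj 2 (fun _ : Fin n => ℝ) i : Vec n →L[ℝ] ℝ)) x :=
    (h i).comp_hasFDerivAt (h₂ := f i) x (PiLp.hasFDerivAt_apply (𝕜 := ℝ) 2 x i)
  rw [hasGradientAt_iff_hasFDerivAt]
  refine (HasFDerivAt.fun_sum fun i _ => hcoord i).congr_fderiv ?_
  ext v
  simp [toDual_apply_apply, inner_eq_sum]

theorem strictConvexOn_sum_apply {f : Fin n → ℝ → ℝ}
    (hf : ∀ i, StrictConvexOn ℝ (Set.Ici 0) (f i)) :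
    StrictConvexOn ℝ (orthant n) fun x : Vec n => ∑ i, f i (x i) := by
  refine ⟨convex_orthant n, fun x hx y hy hxy a c ha hc hac => ?_⟩
  obtain ⟨i, hi⟩ : ∃ i, x i ≠ y i := by
    by_contra! h
    exact hxy (PiLp.ext h)
  simp only [smul_eq_mul, Finset.mul_sum, ← Finset.sum_add_distrib]
  exact Finset.sum_lt_sum
    (fun j _ => (hf j).convexOn.2 (hx j) (hy j) ha.le hc.le hac)
    ⟨i, Finset.mem_univ i, (hf i).2 (hx i) (hy i) hi ha hc hac⟩

end Orthant

/-! ### The Kullback-Leibler divergence of two numbers -/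

/-- The Kullback-Leibler divergence `u log (u / x) - u + x` of two numbers, for `0 ≤ u` and `0 < x`.
Its value for `x = 0`, which should be `+∞` unless `u = 0`, is `0`. -/
def klTerm (u x : ℝ) : ℝ := x * klFun (u / x)

theorem klTerm_eq {u x : ℝ} (h : x = 0 → u = 0) :
    klTerm u x = u * Real.log u - x * Real.log x - (Real.log x + 1) * (u - x) := by
  rcases eq_or_ne x 0 with rfl | hx
  · simp [klTerm, h rfl]
  rcases eq_or_ne u 0 with rfl | hu
  · simp only [klTerm, klFun_apply, zero_div, Real.log_zero]
    ring
  · rw [klTerm, klFun_apply, Real.log_div hu hx]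
    field_simp
    ring

theorem klTerm_self (x : ℝ) : klTerm x x = 0 := by
  rw [klTerm_eq id, sub_self, sub_self, mul_zero, sub_zero]

theorem klTerm_nonneg {u x : ℝ} (hu : 0 ≤ u) (hx : 0 ≤ x) : 0 ≤ klTerm u x :=
  mul_nonneg hx (klFun_nonneg (div_nonneg hu hx))

theorem sq_sqrt_sub_one_le_klFun {t : ℝ} (ht : 0 ≤ t) : (√t - 1) ^ 2 ≤ klFun t := by
  have hdiff : klFun t - (√t - 1) ^ 2 = 2 * √t * klFun √t := by
    obtain ⟨s, hs, rfl⟩ : ∃ s, 0 ≤ s ∧ t = s ^ 2 := ⟨√t, Real.sqrt_nonneg t, (Real.sq_sqrt ht).symm⟩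
    rw [Real.sqrt_sq hs, klFun_apply, klFun_apply, Real.log_pow]
    push_cast
    ring
  have := klFun_nonneg (Real.sqrt_nonneg t)
  exact sub_nonneg.1 (hdiff ▸ by positivity)

theorem sq_sqrt_sub_sqrt_le_klTerm {u x : ℝ} (hu : 0 ≤ u) (hx : 0 < x) :
    (√u - √x) ^ 2 ≤ klTerm u x := by
  have hsqrt : (√u - √x) ^ 2 = x * (√(u / x) - 1) ^ 2 := by
    rw [Real.sqrt_div hu]
    nth_rewrite 2 [← Real.sq_sqrt hx.le]
    have := (Real.sqrt_pos.2 hx).ne'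
    field_simp
  exact hsqrt ▸ mul_le_mul_of_nonneg_left (sq_sqrt_sub_one_le_klFun (div_nonneg hu hx.le)) hx.le

theorem continuous_klTerm_left (x : ℝ) : Continuous fun u => klTerm u x :=
  continuous_const.mul (continuous_klFun.comp (continuous_id.div_const x))

theorem continuousAt_klTerm_right (u : ℝ) : ContinuousAt (klTerm u) u := by
  rcases eq_or_ne u 0 with rfl | hu
  · have hid : klTerm 0 = id := funext fun x => by simp [klTerm, klFun_zero]
    exact hid ▸ continuousAt_id
  · exact continuousAt_id.mul
      (continuous_klFun.continuousAt.comp (continuousAt_const.div continuousAt_id hu))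

theorem klTerm_sum_le {ι : Type*} (s : Finset ι) {a u x : ι → ℝ} (ha : ∀ j ∈ s, 0 ≤ a j)
    (hu : ∀ j ∈ s, 0 ≤ u j) (hx : ∀ j ∈ s, 0 < x j) :
    klTerm (∑ j ∈ s, a j * u j) (∑ j ∈ s, a j * x j) ≤ ∑ j ∈ s, a j * klTerm (u j) (x j) := by
  have hw : ∀ j ∈ s, 0 ≤ a j * x j := fun j hj => mul_nonneg (ha j hj) (hx j hj).le
  rcases (Finset.sum_nonneg hw).eq_or_lt with h0 | hpos
  · rw [← h0, klTerm, zero_mul]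
    exact Finset.sum_nonneg fun j hj =>
      mul_nonneg (ha j hj) (klTerm_nonneg (hu j hj) (hx j hj).le)
  have hjensen := convexOn_klFun.map_centerMass_le (t := s) (w := fun j => a j * x j)
    (p := fun j => u j / x j) hw hpos fun j hj => div_nonneg (hu j hj) (hx j hj).le
  have hmean : ∑ j ∈ s, a j * x j * (u j / x j) = ∑ j ∈ s, a j * u j :=
    Finset.sum_congr rfl fun j hj => by rw [mul_assoc, mul_div_cancel₀ _ (hx j hj).ne']
  simp only [Finset.centerMass, smul_eq_mul, Function.comp_apply, hmean] at hjensen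
  rw [← div_eq_inv_mul, le_inv_mul_iff₀ hpos] at hjensen
  simpa only [klTerm, mul_assoc] using hjensen

/-! ### The relative function and its Bregman distance -/

section RelFun

variable {n : ℕ} {ε : ℝ}

/-- The gradient of `relFun` at the points with positive coordinates. At a zero coordinate it has
the value `1`, as `Real.log 0 = 0`. -/
def relGrad (ε : ℝ) (x : Vec n) : Vec n :=
  WithLp.toLp 2 fun i => Real.log (x i) + 1 + ε * x i

/-- The Bregman distance of `relFun`, in a form that needs no gradient: the Kullback-Leibler
divergence plus `(ε/2) ‖u - x‖²`. -/
def relDiv (ε : ℝ) (u x : Vec n) : ℝ :=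
  ∑ i, klTerm (u i) (x i) + ε / 2 * ‖u - x‖ ^ 2

theorem relFun_eq_sum (ε : ℝ) (x : Vec n) :
    relFun ε x = ∑ i, (x i * Real.log (x i) + ε / 2 * x i ^ 2) := by
  rw [relFun, entropy, EuclideanSpace.real_norm_sq_eq, Finset.mul_sum, Finset.sum_add_distrib]

theorem relFun_eq_add_inner_add_relDiv (ε : ℝ) {u x : Vec n} (h : ∀ i, x i = 0 → u i = 0) :
    relFun ε u = relFun ε x + inner ℝ (relGrad ε x) (u - x) + relDiv ε u x := by
  rw [relFun_eq_sum, relFun_eq_sum, inner_eq_sum, relDiv, EuclideanSpace.real_norm_sq_eq,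
    Finset.mul_sum, ← Finset.sum_add_distrib, ← Finset.sum_add_distrib, ← Finset.sum_add_distrib]
  refine Finset.sum_congr rfl fun i _ => ?_
  simp only [klTerm_eq (h i), relGrad, PiLp.sub_apply]
  ring

theorem relDiv_eq_add_inner_add_relDiv (ε : ℝ) {u x y : Vec n} (hux : ∀ i, x i = 0 → u i = 0)
    (hy : ∀ i, 0 < y i) :
    relDiv ε u y = relDiv ε x y + inner ℝ (relGrad ε x - relGrad ε y) (u - x) + relDiv ε u x := by
  have hu := relFun_eq_add_inner_add_relDiv ε (u := u) fun i hi => ((hy i).ne' hi).elim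
  have hx := relFun_eq_add_inner_add_relDiv ε (u := x) fun i hi => ((hy i).ne' hi).elim
  have hux := relFun_eq_add_inner_add_relDiv ε hux
  simp only [inner_sub_left, inner_sub_right] at hu hx hux ⊢
  linarith

theorem hasGradientAt_relFun (ε : ℝ) {x : Vec n} (hx : ∀ i, 0 < x i) :
    HasGradientAt (relFun ε) (relGrad ε x) x := by
  rw [funext (relFun_eq_sum ε)]
  refine hasGradientAt_sum_apply (f := fun _ t => t * Real.log t + ε / 2 * t ^ 2) fun i => ?_
  refine ((Real.hasDerivAt_mul_log (hx i).ne').add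
    ((hasDerivAt_pow 2 (x i)).const_mul (ε / 2))).congr_deriv ?_
  push_cast
  ring

theorem bregman_relFun (ε : ℝ) (u : Vec n) {x : Vec n} (hx : ∀ i, 0 < x i) :
    bregman (relFun ε) u x = relDiv ε u x := by
  rw [bregman, (hasGradientAt_relFun ε hx).gradient,
    relFun_eq_add_inner_add_relDiv ε (u := u) fun i hi => ((hx i).ne' hi).elim]
  ring

theorem relDiv_self (ε : ℝ) (x : Vec n) : relDiv ε x x = 0 := by
  simp [relDiv, klTerm_self]

theorem relDiv_nonneg (hε : 0 ≤ ε) {u x : Vec n} (hu : u ∈ orthant n) (hx : x ∈ orthant n) :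
    0 ≤ relDiv ε u x := by
  have := Finset.sum_nonneg fun i (_ : i ∈ Finset.univ) => klTerm_nonneg (hu i) (hx i)
  unfold relDiv
  positivity

theorem sq_sqrt_sub_sqrt_le_relDiv (hε : 0 ≤ ε) {u x : Vec n} (hu : u ∈ orthant n)
    (hx : ∀ i, 0 < x i) (i : Fin n) : (√(u i) - √(x i)) ^ 2 ≤ relDiv ε u x :=
  calc (√(u i) - √(x i)) ^ 2
    _ ≤ klTerm (u i) (x i) := sq_sqrt_sub_sqrt_le_klTerm (hu i) (hx i)
    _ ≤ ∑ j, klTerm (u j) (x j) := Finset.single_le_sum (f := fun j => klTerm (u j) (x j))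
        (fun j _ => klTerm_nonneg (hu j) (hx j).le) (Finset.mem_univ i)
    _ ≤ relDiv ε u x := le_add_of_nonneg_right (by positivity)

theorem relDiv_pos (hε : 0 ≤ ε) {u x : Vec n} (hu : u ∈ orthant n) (hx : ∀ i, 0 < x i)
    (hne : u ≠ x) : 0 < relDiv ε u x := by
  obtain ⟨i, hi⟩ : ∃ i, u i ≠ x i := by
    by_contra! h
    exact hne (PiLp.ext h)
  have hsqrt : √(u i) - √(x i) ≠ 0 :=
    sub_ne_zero.2 fun h => hi ((Real.sqrt_inj (hu i) (hx i).le).1 h)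
  exact (sq_pos_of_ne_zero hsqrt).trans_le (sq_sqrt_sub_sqrt_le_relDiv hε hu hx i)

theorem le_sq_of_sq_sqrt_sub_le {s t C : ℝ} (hs : 0 ≤ s) (h : (√s - √t) ^ 2 ≤ C) :
    s ≤ (√t + √C) ^ 2 := by
  have hsqrt : √s - √t ≤ √C := Real.le_sqrt_of_sq_le h
  rw [← Real.sq_sqrt hs]
  exact pow_le_pow_left₀ (Real.sqrt_nonneg _) (by linarith) 2

theorem mem_box_of_relDiv_le_left (hε : 0 ≤ ε) {u x : Vec n} {C : ℝ} (hu : u ∈ orthant n)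
    (hx : ∀ i, 0 < x i) (h : relDiv ε u x ≤ C) : u ∈ box fun i => (√(x i) + √C) ^ 2 := fun i =>
  ⟨hu i, le_sq_of_sq_sqrt_sub_le (hu i) ((sq_sqrt_sub_sqrt_le_relDiv hε hu hx i).trans h)⟩

theorem mem_box_of_relDiv_le_right (hε : 0 ≤ ε) {u x : Vec n} {C : ℝ} (hu : u ∈ orthant n)
    (hx : ∀ i, 0 < x i) (h : relDiv ε u x ≤ C) : x ∈ box fun i => (√(u i) + √C) ^ 2 := fun i => by
  have hi := (sq_sqrt_sub_sqrt_le_relDiv hε hu hx i).trans h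
  exact ⟨(hx i).le, le_sq_of_sq_sqrt_sub_le (hx i).le (by rwa [← neg_sub, neg_sq])⟩

theorem continuous_relDiv_left (ε : ℝ) (x : Vec n) : Continuous fun u => relDiv ε u x := by
  have hkl (i : Fin n) : Continuous fun u : Vec n => klTerm (u i) (x i) :=
    (continuous_klTerm_left (x i)).comp (by fun_prop)
  unfold relDiv
  fun_prop

theorem strictConvexOn_relDiv_left (hε : 0 ≤ ε) {x : Vec n} (hx : ∀ i, 0 < x i) :
    StrictConvexOn ℝ (orthant n) fun u => relDiv ε u x := by
  have hentropy : StrictConvexOn ℝ (orthant n) fun u : Vec n => ∑ i, u i * Real.log (u i) :=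
    strictConvexOn_sum_apply fun _ => Real.strictConvexOn_mul_log
  have hsq : ConvexOn ℝ (orthant n) fun u : Vec n => ε / 2 * ‖u‖ ^ 2 :=
    ((convexOn_norm (convex_orthant n)).pow (fun _ _ => norm_nonneg _) 2).smul
      (div_nonneg hε zero_le_two)
  have hlinear : ConvexOn ℝ (orthant n) fun u : Vec n => -inner ℝ (relGrad ε x) u :=
    (-(toDual ℝ (Vec n) (relGrad ε x)).toLinearMap).convexOn (convex_orthant n)
  refine (((hentropy.add_convexOn hsq).add_convexOn hlinear).add_const
    (inner ℝ (relGrad ε x) x - relFun ε x)).congr fun u _ => ?_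
  have h := relFun_eq_add_inner_add_relDiv ε (u := u) fun i hi => ((hx i).ne' hi).elim
  rw [relFun, entropy, inner_sub_right] at h
  simp only [Pi.add_apply]
  linarith

theorem tendsto_relDiv_right (ε : ℝ) {ι : Type*} {l : Filter ι} {x : ι → Vec n} {a : Vec n}
    (h : Tendsto x l (𝓝 a)) : Tendsto (fun k => relDiv ε a (x k)) l (𝓝 0) := by
  have hcoord (i : Fin n) : ContinuousAt (fun y : Vec n => klTerm (a i) (y i)) a :=
    (continuousAt_klTerm_right (a i)).comp (f := fun y : Vec n => y i) (by fun_prop)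
  have hcont : ContinuousAt (relDiv ε a) a := by
    unfold relDiv
    fun_prop
  exact relDiv_self ε a ▸ hcont.tendsto.comp h

theorem tendsto_of_tendsto_relDiv (hε : 0 ≤ ε) {ι : Type*} {l : Filter ι} {x : ι → Vec n}
    {a : Vec n} (ha : a ∈ orthant n) (hx : ∀ k i, 0 < x k i)
    (h : Tendsto (fun k => relDiv ε a (x k)) l (𝓝 0)) : Tendsto x l (𝓝 a) := by
  refine tendsto_of_tendsto_apply fun i => ?_
  have hsq : Tendsto (fun k => (√(a i) - √(x k i)) ^ 2) l (𝓝 0) :=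
    squeeze_zero (fun _ => sq_nonneg _) (fun k => sq_sqrt_sub_sqrt_le_relDiv hε ha (hx k) i) h
  have hdiff : Tendsto (fun k => √(a i) - √(x k i)) l (𝓝 0) :=
    (tendsto_zero_iff_abs_tendsto_zero _).2 <| by
      simpa [Function.comp_def, Real.sqrt_sq_eq_abs] using (Real.continuous_sqrt.tendsto 0).comp hsq
  simpa [Real.sq_sqrt (ha i), fun k => Real.sq_sqrt (hx k i).le] using
    (hdiff.const_sub (√(a i))).pow 2

theorem exists_log_add_mul_eq (hε : 0 ≤ ε) (c : ℝ) : ∃ t, 0 < t ∧ Real.log t + 1 + ε * t = c := by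
  have hcont : Continuous fun s : ℝ => s + 1 + ε * Real.exp s := by fun_prop
  have htop : Tendsto (fun s : ℝ => s + 1) atTop atTop :=
    tendsto_atTop_add_const_right _ _ tendsto_id
  have hbot : Tendsto (fun s : ℝ => s + 1) atBot atBot :=
    tendsto_atBot_add_const_right _ _ tendsto_id
  obtain ⟨s, hs⟩ := hcont.surjective
    (tendsto_atTop_mono (fun s => le_add_of_nonneg_right (mul_nonneg hε (Real.exp_pos s).le)) htop)
    (hbot.atBot_add (Real.tendsto_exp_atBot.const_mul ε)) c
  exact ⟨Real.exp s, Real.exp_pos s, by simpa using hs⟩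

theorem exists_relGrad_eq (hε : 0 ≤ ε) (c : Vec n) : ∃ x, (∀ i, 0 < x i) ∧ relGrad ε x = c := by
  choose t htpos ht using fun i => exists_log_add_mul_eq hε (c i)
  exact ⟨WithLp.toLp 2 t, htpos, PiLp.ext ht⟩

theorem tendsto_relGrad (ε : ℝ) {ι : Type*} {l : Filter ι} {x : ι → Vec n} {a : Vec n}
    (ha : ∀ i, 0 < a i) (h : Tendsto x l (𝓝 a)) :
    Tendsto (fun k => relGrad ε (x k)) l (𝓝 (relGrad ε a)) := by
  refine tendsto_of_tendsto_apply fun i => ?_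
  have hi : Tendsto (fun k => x k i) l (𝓝 (a i)) :=
    ((by fun_prop : Continuous fun y : Vec n => y i).tendsto a).comp h
  exact ((hi.log (ha i).ne').add_const 1).add (hi.const_mul ε)

theorem exists_forall_relDiv_lt (hε : 0 ≤ ε) {S : Set (Vec n)} (hclosed : IsClosed S)
    (hconvex : Convex ℝ S) (hne : S.Nonempty) (hS : S ⊆ orthant n) {y : Vec n}
    (hy : ∀ i, 0 < y i) : ∃ a ∈ S, ∀ z ∈ S, z ≠ a → relDiv ε a y < relDiv ε z y := by
  obtain ⟨z₀, hz₀⟩ := hne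
  have hcoercive : ∀ᶠ z in cocompact (Vec n) ⊓ 𝓟 S, relDiv ε z₀ y ≤ relDiv ε z y := by
    rw [eventually_inf_principal]
    filter_upwards [(isCompact_box fun i => (√(y i) + √(relDiv ε z₀ y)) ^ 2).compl_mem_cocompact]
      with z hz hzS
    by_contra! hlt
    exact hz (mem_box_of_relDiv_le_left hε (hS hzS) hy hlt.le)
  obtain ⟨a, ha, hmin⟩ :=
    (continuous_relDiv_left ε y).continuousOn.exists_isMinOn' hclosed hz₀ hcoercive
  refine ⟨a, ha, fun z hz hza => (hmin hz).lt_of_ne fun heq => hza ?_⟩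
  exact ((strictConvexOn_relDiv_left hε hy).subset hS hconvex).eq_of_isMinOn
    (fun w hw => heq.symm.trans_le (hmin hw)) hmin hz ha

end RelFun

/-! ### The symmetry coefficient -/

theorem bddBelow_bregman_ratios (n : ℕ) {ε : ℝ} (hε : 0 ≤ ε) :
    BddBelow {r | ∃ x ∈ interior (orthant n), ∃ y ∈ interior (orthant n),
      x ≠ y ∧ r = bregman (relFun ε) x y / bregman (relFun ε) y x} := by
  refine ⟨0, ?_⟩
  rintro _ ⟨x, hx, y, hy, -, rfl⟩
  rw [bregman_relFun ε x (mem_interior_orthant.1 hy),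
    bregman_relFun ε y (mem_interior_orthant.1 hx)]
  exact div_nonneg (relDiv_nonneg hε (interior_subset hx) (interior_subset hy))
    (relDiv_nonneg hε (interior_subset hy) (interior_subset hx))

theorem tendsto_klTerm_ratio (ε : ℝ) (hε : 0 ≤ ε) :
    Tendsto (fun t => (klTerm t 1 + ε / 2 * (t - 1) ^ 2) / (klTerm 1 t + ε / 2 * (1 - t) ^ 2))
      (𝓝[>] 0) (𝓝 0) := by
  have hnum : Tendsto (fun t => klTerm t 1 + ε / 2 * (t - 1) ^ 2) (𝓝[>] 0)
      (𝓝 (klTerm 0 1 + ε / 2 * (0 - 1) ^ 2)) := by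
    have := continuous_klTerm_left 1
    have hcont : Continuous fun t => klTerm t 1 + ε / 2 * (t - 1) ^ 2 := by fun_prop
    exact (hcont.tendsto 0).mono_left nhdsWithin_le_nhds
  have hden : Tendsto (fun t : ℝ => -Real.log t + -1) (𝓝[>] 0) atTop :=
    tendsto_atTop_add_const_right _ _ (tendsto_neg_atBot_atTop.comp Real.tendsto_log_nhdsGT_zero)
  refine hnum.div_atTop (tendsto_atTop_mono' _ ?_ hden)
  filter_upwards [self_mem_nhdsWithin] with t (ht : 0 < t)
  have hquad : 0 ≤ ε / 2 * (1 - t) ^ 2 := by positivity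
  simp only [klTerm_eq fun h => (ht.ne' h).elim, Real.log_one]
  linarith

theorem relDiv_smul_ones (n : ℕ) (ε s t : ℝ) :
    relDiv ε (s • ones n) (t • ones n) = n * (klTerm s t + ε / 2 * (s - t) ^ 2) := by
  rw [relDiv, EuclideanSpace.real_norm_sq_eq]
  simp [ones]
  ring

/-- The quotient of Bregman distances vanishes in the limit for the points `(t, …, t)` and
`(1, …, 1)` as `t → 0`. -/
theorem symCoeff_nonpos (n : ℕ) {ε : ℝ} (hε : 0 ≤ ε) : symCoeff n ε ≤ 0 := by
  rcases Nat.eq_zero_or_pos n with rfl | hn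
  · simp [symCoeff, Subsingleton.elim (_ : Vec 0) 0]
  have hn' : (n : ℝ) ≠ 0 := Nat.cast_ne_zero.2 hn.ne'
  refine ge_of_tendsto (tendsto_klTerm_ratio ε hε) ?_
  filter_upwards [Ioo_mem_nhdsGT zero_lt_one] with t ht
  have hpos {s : ℝ} (hs : 0 < s) (i : Fin n) : 0 < (s • ones n) i := by simpa [ones] using hs
  have hne : t • ones n ≠ (1 : ℝ) • ones n := fun h =>
    ht.2.ne (by simpa [ones] using congrArg (fun z : Vec n => z ⟨0, hn⟩) h)
  refine csInf_le (bddBelow_bregman_ratios n hε) ⟨t • ones n, mem_interior_orthant.2 (hpos ht.1),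
    (1 : ℝ) • ones n, mem_interior_orthant.2 (hpos one_pos), hne, ?_⟩
  rw [bregman_relFun ε _ (hpos one_pos), bregman_relFun ε _ (hpos ht.1), relDiv_smul_ones,
    relDiv_smul_ones, mul_div_mul_left _ _ hn']

theorem mul_le_one_of_lt_one_add_symCoeff_sub_div {n : ℕ} {ε δ L ω : ℝ} (hε : 0 ≤ ε) (hL : 0 < L)
    (hω : 0 ≤ ω) (h : δ < (1 + symCoeff n ε - ω) / L) : δ * L ≤ 1 := by
  rw [lt_div_iff₀ hL] at h
  linarith [symCoeff_nonpos n hε]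

/-! ### The energy -/

section Energy

variable {m n : ℕ} {A : Matrix (Fin m) (Fin n) ℝ} {b : Vec m} {ε : ℝ}

theorem linOp_apply (A : Matrix (Fin m) (Fin n) ℝ) (x : Vec n) (i : Fin m) :
    linOp A x i = ∑ j, A i j * x j := by
  simp [linOp, Matrix.toLpLin_apply, Matrix.mulVec, dotProduct]

theorem linOp_mem_orthant (hA : ∀ i j, 0 ≤ A i j) {x : Vec n} (hx : x ∈ orthant n) :
    linOp A x ∈ orthant m := fun i => by
  rw [linOp_apply]
  exact Finset.sum_nonneg fun j _ => mul_nonneg (hA i j) (hx j)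

theorem linOp_apply_eq_zero (hA : ∀ i j, 0 ≤ A i j) {x : Vec n} (hx : ∀ j, 0 < x j) (u : Vec n)
    (i : Fin m) (hi : linOp A x i = 0) : linOp A u i = 0 := by
  rw [linOp_apply] at hi ⊢
  refine Finset.sum_eq_zero fun j hj => ?_
  have hAx := (Finset.sum_eq_zero_iff_of_nonneg fun j _ => mul_nonneg (hA i j) (hx j).le).1 hi j hj
  rw [(mul_eq_zero.1 hAx).resolve_right (hx j).ne', zero_mul]

theorem relDiv_linOp_le (hε : 0 ≤ ε) (hA : ∀ i j, 0 ≤ A i j) {L : ℝ} (hnorm : ‖linOp A‖ ^ 2 ≤ L)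
    (hcol : ∀ j, ∑ i, A i j ≤ L) {u x : Vec n} (hu : u ∈ orthant n) (hx : ∀ j, 0 < x j) :
    relDiv ε (linOp A u) (linOp A x) ≤ L * relDiv ε u x := by
  have hkl : ∑ i, klTerm (linOp A u i) (linOp A x i) ≤ L * ∑ j, klTerm (u j) (x j) :=
    calc ∑ i, klTerm (linOp A u i) (linOp A x i)
      _ ≤ ∑ i, ∑ j, A i j * klTerm (u j) (x j) := Finset.sum_le_sum fun i _ => by
          rw [linOp_apply, linOp_apply]
          exact klTerm_sum_le _ (fun j _ => hA i j) (fun j _ => hu j) fun j _ => hx j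
      _ = ∑ j, (∑ i, A i j) * klTerm (u j) (x j) := by
          rw [Finset.sum_comm]
          simp only [Finset.sum_mul]
      _ ≤ ∑ j, L * klTerm (u j) (x j) := Finset.sum_le_sum fun j _ =>
          mul_le_mul_of_nonneg_right (hcol j) (klTerm_nonneg (hu j) (hx j).le)
      _ = L * ∑ j, klTerm (u j) (x j) := (Finset.mul_sum ..).symm
  have hsq : ‖linOp A u - linOp A x‖ ^ 2 ≤ L * ‖u - x‖ ^ 2 :=
    calc ‖linOp A u - linOp A x‖ ^ 2
      _ ≤ (‖linOp A‖ * ‖u - x‖) ^ 2 := by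
          rw [← map_sub]
          exact pow_le_pow_left₀ (norm_nonneg _) ((linOp A).le_opNorm _) 2
      _ = ‖linOp A‖ ^ 2 * ‖u - x‖ ^ 2 := mul_pow ..
      _ ≤ L * ‖u - x‖ ^ 2 := mul_le_mul_of_nonneg_right hnorm (sq_nonneg _)
  have := mul_le_mul_of_nonneg_left hsq (div_nonneg hε zero_le_two)
  unfold relDiv
  linarith

theorem energy_eq_relDiv (A : Matrix (Fin m) (Fin n) ℝ) (ε : ℝ) (hb : ∀ i, 0 < b i) (x : Vec n) :
    energy A b ε x = relDiv ε (linOp A x) b := by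
  have hentropy : (entropy : Vec m → ℝ) = relFun 0 := funext fun y => by simp [relFun]
  rw [energy, hentropy, bregman_relFun 0 _ hb, relDiv, relDiv, zero_div, zero_mul, add_zero]

theorem continuous_energy (A : Matrix (Fin m) (Fin n) ℝ) (ε : ℝ) (hb : ∀ i, 0 < b i) :
    Continuous (energy A b ε) := by
  rw [funext (energy_eq_relDiv A ε hb)]
  exact (continuous_relDiv_left ε b).comp (linOp A).continuous

theorem convexOn_energy (hA : ∀ i j, 0 ≤ A i j) (hε : 0 ≤ ε) (hb : ∀ i, 0 < b i) :
    ConvexOn ℝ (orthant n) (energy A b ε) := by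
  rw [funext (energy_eq_relDiv A ε hb)]
  exact ((strictConvexOn_relDiv_left hε hb).convexOn.comp_linearMap (linOp A).toLinearMap).subset
    (fun _ hx => linOp_mem_orthant hA hx) (convex_orthant n)

/-- The gradient of the energy at the points with positive coordinates. A zero row of `A`, for which
`relGrad` has a junk value, does not contribute. -/
def energyGrad (A : Matrix (Fin m) (Fin n) ℝ) (b : Vec m) (ε : ℝ) (x : Vec n) : Vec n :=
  ContinuousLinearMap.adjoint (linOp A) (relGrad ε (linOp A x) - relGrad ε b)

theorem energy_eq_add_inner_add_relDiv (hA : ∀ i j, 0 ≤ A i j) (ε : ℝ) (hb : ∀ i, 0 < b i)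
    (u : Vec n) {x : Vec n} (hx : ∀ j, 0 < x j) :
    energy A b ε u = energy A b ε x + inner ℝ (energyGrad A b ε x) (u - x)
      + relDiv ε (linOp A u) (linOp A x) := by
  rw [energy_eq_relDiv A ε hb, energy_eq_relDiv A ε hb, energyGrad,
    ContinuousLinearMap.adjoint_inner_left, map_sub]
  exact relDiv_eq_add_inner_add_relDiv ε (linOp_apply_eq_zero hA hx u) hb

theorem hasGradientAt_energy (hA : ∀ i j, 0 ≤ A i j) (hε : 0 ≤ ε) (hb : ∀ i, 0 < b i) {x : Vec n}
    (hx : ∀ j, 0 < x j) : HasGradientAt (energy A b ε) (energyGrad A b ε x) x := by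
  have hrel : (fun u => relDiv ε u x) =o[𝓝 x] fun u => u - x := by
    refine (hasGradientAt_iff_isLittleO.1 (hasGradientAt_relFun ε hx)).congr_left fun u => ?_
    rw [relFun_eq_add_inner_add_relDiv ε (u := u) fun i hi => ((hx i).ne' hi).elim]
    ring
  have hcols : 0 ≤ ∑ j, ∑ i, A i j :=
    Finset.sum_nonneg fun j _ => Finset.sum_nonneg fun i _ => hA i j
  have hbound : (fun u => relDiv ε (linOp A u) (linOp A x)) =O[𝓝 x] fun u => relDiv ε u x := by
    refine Asymptotics.IsBigO.of_bound (‖linOp A‖ ^ 2 + ∑ j, ∑ i, A i j) ?_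
    filter_upwards [mem_interior_iff_mem_nhds.1 (mem_interior_orthant.2 hx)] with u hu
    have hx' := mem_orthant_of_pos hx
    rw [Real.norm_of_nonneg (relDiv_nonneg hε (linOp_mem_orthant hA hu) (linOp_mem_orthant hA hx')),
      Real.norm_of_nonneg (relDiv_nonneg hε hu hx')]
    refine relDiv_linOp_le hε hA (le_add_of_nonneg_right hcols) (fun j => ?_) hu hx
    exact (Finset.single_le_sum (f := fun j => ∑ i, A i j)
      (fun j _ => Finset.sum_nonneg fun i _ => hA i j) (Finset.mem_univ j)).trans
      (le_add_of_nonneg_left (sq_nonneg _))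
  refine hasGradientAt_iff_isLittleO.2 ((hbound.trans_isLittleO hrel).congr_left fun u => ?_)
  rw [energy_eq_add_inner_add_relDiv hA ε hb u hx]
  ring

theorem lipschitzLike_iff (hA : ∀ i j, 0 ≤ A i j) (hε : 0 ≤ ε) (hb : ∀ i, 0 < b i) {L : ℝ} :
    LipschitzLike A b ε L ↔ ∀ x : Vec n, (∀ j, 0 < x j) → ∀ y : Vec n, (∀ j, 0 < y j) →
      relDiv ε (linOp A y) (linOp A x) ≤ L * relDiv ε y x := by
  have hgrad : ∀ x ∈ interior (orthant n), HasGradientAt (fun x => L * relFun ε x - energy A b ε x)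
      (L • relGrad ε x - energyGrad A b ε x) x := fun x hx => by
    rw [mem_interior_orthant] at hx
    rw [hasGradientAt_iff_hasFDerivAt, map_sub, map_smul]
    exact ((hasGradientAt_relFun ε hx).hasFDerivAt.const_mul L).sub
      (hasGradientAt_energy hA hε hb hx).hasFDerivAt
  rw [LipschitzLike, convexOn_iff_add_inner_le (convex_orthant n).interior hgrad]
  simp only [mem_interior_orthant]
  refine forall₂_congr fun x hx => forall₂_congr fun y _ => ?_
  rw [energy_eq_add_inner_add_relDiv hA ε hb y hx,
    relFun_eq_add_inner_add_relDiv ε (u := y) fun i hi => ((hx i).ne' hi).elim, inner_sub_left,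
    real_inner_smul_left]
  constructor <;> intro h <;> linarith

theorem lipschitzLike_of_le (hA : ∀ i j, 0 ≤ A i j) (hε : 0 ≤ ε) (hb : ∀ i, 0 < b i) {L : ℝ}
    (hnorm : ‖linOp A‖ ^ 2 ≤ L) (hcol : ∀ j, ∑ i, A i j ≤ L) : LipschitzLike A b ε L :=
  (lipschitzLike_iff hA hε hb).2 fun _ hx _ hy =>
    relDiv_linOp_le hε hA hnorm hcol (mem_orthant_of_pos hy) hx

/-! ### The minimizers of the energy -/

theorem mem_X0_iff {x : Vec n} :
    x ∈ X0 A b ε ↔ x ∈ orthant n ∧ ∀ z ∈ orthant n, energy A b ε x ≤ energy A b ε z := by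
  rw [X0, closure_orthant, Set.mem_ofPred_eq]

theorem X0_subset_orthant : X0 A b ε ⊆ orthant n := fun _ hx => (mem_X0_iff.1 hx).1

theorem isClosed_X0 (A : Matrix (Fin m) (Fin n) ℝ) (ε : ℝ) (hb : ∀ i, 0 < b i) :
    IsClosed (X0 A b ε) := by
  have hX0 : X0 A b ε = orthant n ∩ ⋂ z ∈ orthant n, {x | energy A b ε x ≤ energy A b ε z} := by
    ext x
    simp [mem_X0_iff]
  exact hX0 ▸ (isClosed_orthant n).inter (isClosed_biInter fun z _ =>
    isClosed_le (continuous_energy A ε hb) continuous_const)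

theorem convex_X0 (hA : ∀ i j, 0 ≤ A i j) (hε : 0 ≤ ε) (hb : ∀ i, 0 < b i) :
    Convex ℝ (X0 A b ε) := by
  intro x hx y hy a c ha hc hac
  rw [mem_X0_iff] at hx hy ⊢
  refine ⟨convex_orthant n hx.1 hy.1 ha hc hac, fun z hz => ?_⟩
  calc energy A b ε (a • x + c • y)
    _ ≤ a * energy A b ε x + c * energy A b ε y :=
        (convexOn_energy hA hε hb).2 hx.1 hy.1 ha hc hac
    _ ≤ a * energy A b ε z + c * energy A b ε z :=
        add_le_add (mul_le_mul_of_nonneg_left (hx.2 z hz) ha)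
          (mul_le_mul_of_nonneg_left (hy.2 z hz) hc)
    _ = energy A b ε z := by rw [← add_mul, hac, one_mul]

theorem linOp_eq_of_mem_X0 (hA : ∀ i j, 0 ≤ A i j) (hε : 0 ≤ ε) (hb : ∀ i, 0 < b i) {x y : Vec n}
    (hx : x ∈ X0 A b ε) (hy : y ∈ X0 A b ε) : linOp A x = linOp A y := by
  have himage : linOp A '' orthant n ⊆ orthant m :=
    Set.image_subset_iff.2 fun _ hz => linOp_mem_orthant hA hz
  have hmin {z : Vec n} (hz : z ∈ X0 A b ε) :
      IsMinOn (fun v => relDiv ε v b) (linOp A '' orthant n) (linOp A z) := by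
    rintro _ ⟨w, hw, rfl⟩
    have h := (mem_X0_iff.1 hz).2 w hw
    rwa [energy_eq_relDiv A ε hb, energy_eq_relDiv A ε hb] at h
  exact ((strictConvexOn_relDiv_left hε hb).subset himage
    ((convex_orthant n).linear_image (linOp A).toLinearMap)).eq_of_isMinOn (hmin hx) (hmin hy)
    ⟨x, X0_subset_orthant hx, rfl⟩ ⟨y, X0_subset_orthant hy, rfl⟩

theorem exists_mem_box_linOp_eq (hA : ∀ i j, 0 ≤ A i j) (R : Fin m → ℝ) :
    ∃ r : Fin n → ℝ, ∀ x ∈ orthant n, linOp A x ∈ box R →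
      ∃ y ∈ box r, linOp A y = linOp A x := by
  -- In a zero column of `A` the sum is `0`, as `R i / 0 = 0`, and `y` has the coordinate `0`.
  refine ⟨fun j => ∑ i, R i / A i j, fun x hx hR => ?_⟩
  have hterm (i : Fin m) (j : Fin n) : 0 ≤ R i / A i j :=
    div_nonneg ((hR i).1.trans (hR i).2) (hA i j)
  refine ⟨WithLp.toLp 2 fun j => min (x j) (∑ i, R i / A i j), fun j =>
    ⟨le_min (hx j) (Finset.sum_nonneg fun i _ => hterm i j), min_le_right _ _⟩,
    PiLp.ext fun i => ?_⟩
  rw [linOp_apply, linOp_apply]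
  refine Finset.sum_congr rfl fun j _ => ?_
  rcases (hA i j).eq_or_lt with hij | hij
  · rw [← hij, zero_mul, zero_mul]
  have hAx : A i j * x j ≤ R i := calc
    A i j * x j ≤ linOp A x i := by
      rw [linOp_apply]
      exact Finset.single_le_sum (f := fun j => A i j * x j)
        (fun j _ => mul_nonneg (hA i j) (hx j)) (Finset.mem_univ j)
    _ ≤ R i := (hR i).2
  have hxj : x j ≤ ∑ i, R i / A i j := ((le_div_iff₀' hij).2 hAx).trans
    (Finset.single_le_sum (f := fun i => R i / A i j) (fun i _ => hterm i j) (Finset.mem_univ i))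
  exact congrArg (A i j * ·) (min_eq_left hxj)

theorem X0_nonempty (hA : ∀ i j, 0 ≤ A i j) (hε : 0 ≤ ε) (hb : ∀ i, 0 < b i) :
    (X0 A b ε).Nonempty := by
  obtain ⟨r, hr⟩ := exists_mem_box_linOp_eq hA fun i => (√(b i) + √(energy A b ε 0)) ^ 2
  have hsublevel : ∀ x ∈ orthant n, energy A b ε x ≤ energy A b ε 0 →
      ∃ y ∈ box r, energy A b ε y = energy A b ε x := fun x hx hle => by
    rw [energy_eq_relDiv A ε hb x] at hle
    obtain ⟨y, hy, hyx⟩ :=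
      hr x hx (mem_box_of_relDiv_le_left hε (linOp_mem_orthant hA hx) hb hle)
    exact ⟨y, hy, by rw [energy_eq_relDiv A ε hb, energy_eq_relDiv A ε hb, hyx]⟩
  obtain ⟨y₀, hy₀, hEy₀⟩ := hsublevel 0 (fun _ => le_rfl) le_rfl
  obtain ⟨z, hz, hmin⟩ :=
    (isCompact_box r).exists_isMinOn ⟨y₀, hy₀⟩ (continuous_energy A ε hb).continuousOn
  refine ⟨z, mem_X0_iff.2 ⟨fun j => (hz j).1, fun x hx => ?_⟩⟩
  rcases le_total (energy A b ε x) (energy A b ε 0) with hle | hle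
  · obtain ⟨y, hy, hEy⟩ := hsublevel x hx hle
    exact (hmin hy).trans_eq hEy
  · exact ((hmin hy₀).trans_eq hEy₀).trans hle

end Energy

/-! ### The subproblems and the regularized problem -/

section Regularized

variable {m n : ℕ} {A : Matrix (Fin m) (Fin n) ℝ} {b : Vec m} {ε μ δ : ℝ}

theorem subObj_eq_add_inner_add_relDiv (ε μ δ : ℝ) (q : Vec n) {w x : Vec n} (hw : w ∈ orthant n)
    (hx : ∀ i, 0 < x i) :
    subObj ε μ δ q w = subObj ε μ δ q x
      + inner ℝ (relGrad ε x + (δ * μ) • ones n + q) (w - x) + relDiv ε w x := by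
  have h := relFun_eq_add_inner_add_relDiv ε (u := w) fun i hi => ((hx i).ne' hi).elim
  rw [relFun, relFun] at h
  rw [subObj, subObj, l1_eq_inner_ones hw, l1_eq_inner_ones (mem_orthant_of_pos hx)]
  simp only [inner_add_left, inner_sub_right, real_inner_smul_left] at h ⊢
  linarith

theorem exists_forall_subObj_lt (μ δ : ℝ) (hε : 0 ≤ ε) (q : Vec n) :
    ∃ z, (∀ i, 0 < z i) ∧ relGrad ε z = -q - (δ * μ) • ones n ∧
      ∀ w ∈ orthant n, w ≠ z → subObj ε μ δ q z < subObj ε μ δ q w := by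
  obtain ⟨z, hz, hgrad⟩ := exists_relGrad_eq hε (-q - (δ * μ) • ones n)
  refine ⟨z, hz, hgrad, fun w hw hne => ?_⟩
  have hcrit : relGrad ε z + (δ * μ) • ones n + q = 0 := by rw [hgrad]; abel
  rw [subObj_eq_add_inner_add_relDiv ε μ δ q hw hz, hcrit, inner_zero_left, add_zero]
  exact lt_add_of_pos_right _ (relDiv_pos hε hw hz hne)

theorem mul_regObj (ε μ : ℝ) (hδ : δ ≠ 0) (x : Vec n) :
    δ * regObj ε μ δ x = subObj ε μ δ 0 x := by
  rw [regObj, subObj, inner_zero_left]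
  field_simp
  ring

theorem exists_forall_regObj_lt (μ : ℝ) (hε : 0 ≤ ε) (hδ : 0 < δ) {S : Set (Vec n)}
    (hclosed : IsClosed S) (hconvex : Convex ℝ S) (hne : S.Nonempty) (hS : S ⊆ orthant n) :
    ∃ a ∈ S, ∀ z ∈ S, z ≠ a → regObj ε μ δ a < regObj ε μ δ z := by
  obtain ⟨y, hy, hgrad⟩ := exists_relGrad_eq hε (-(δ * μ) • ones n)
  obtain ⟨a, ha, hlt⟩ := exists_forall_relDiv_lt hε hclosed hconvex hne hS hy
  have hobj : ∀ w ∈ S, δ * regObj ε μ δ w = subObj ε μ δ 0 y + relDiv ε w y := fun w hw => by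
    rw [mul_regObj ε μ hδ.ne', subObj_eq_add_inner_add_relDiv ε μ δ 0 (hS hw) hy, hgrad, neg_smul,
      neg_add_cancel, zero_add, inner_zero_left, add_zero]
  refine ⟨a, ha, fun z hz hza => lt_of_mul_lt_mul_left ?_ hδ.le⟩
  rw [hobj a ha, hobj z hz]
  exact add_lt_add_right (hlt z hz hza) _

theorem regObj_le_of_mem_range (hε : 0 ≤ ε) (hδ : 0 < δ) {x z : Vec n} (hx : ∀ i, 0 < x i)
    (hz : z ∈ orthant n) (hlinOp : linOp A z = linOp A x)
    (hrange : relGrad ε x + (δ * μ) • ones n ∈ (ContinuousLinearMap.adjoint (linOp A)).range) :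
    regObj ε μ δ x ≤ regObj ε μ δ z := by
  obtain ⟨w, hw⟩ := hrange
  have horth : inner ℝ (relGrad ε x + (δ * μ) • ones n) (z - x) = 0 := by
    rw [← hw, ContinuousLinearMap.coe_coe, ContinuousLinearMap.adjoint_inner_left, map_sub, hlinOp,
      sub_self, inner_zero_right]
  refine le_of_mul_le_mul_left ?_ hδ
  rw [mul_regObj ε μ hδ.ne', mul_regObj ε μ hδ.ne', subObj_eq_add_inner_add_relDiv ε μ δ 0 hz hx,
    add_zero, horth, add_zero]
  exact le_add_of_nonneg_right (relDiv_nonneg hε hz (mem_orthant_of_pos hx))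

end Regularized

/-! ### Mirror descent -/

section MirrorDescent

variable {m n : ℕ} {A : Matrix (Fin m) (Fin n) ℝ} {b : Vec m} {ε δ L : ℝ}

theorem relDiv_le_of_step (hA : ∀ i j, 0 ≤ A i j) (hε : 0 ≤ ε) (hb : ∀ i, 0 < b i) (hδ : 0 ≤ δ)
    (hL : LipschitzLike A b ε L) (hδL : δ * L ≤ 1) {u x y : Vec n} (hu : u ∈ orthant n)
    (hx : ∀ i, 0 < x i) (hy : ∀ i, 0 < y i)
    (hstep : relGrad ε y = relGrad ε x - δ • energyGrad A b ε x) :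
    relDiv ε u y ≤ relDiv ε u x + δ * (energy A b ε u - energy A b ε y) := by
  have hthree := relDiv_eq_add_inner_add_relDiv ε (u := u) (fun i hi => ((hy i).ne' hi).elim) hx
  have henergy_u := energy_eq_add_inner_add_relDiv hA ε hb u hx
  have henergy_y := energy_eq_add_inner_add_relDiv hA ε hb y hx
  have hconvex : 0 ≤ δ * relDiv ε (linOp A u) (linOp A x) := mul_nonneg hδ <|
    relDiv_nonneg hε (linOp_mem_orthant hA hu) (linOp_mem_orthant hA (mem_orthant_of_pos hx))
  have hsmooth : δ * relDiv ε (linOp A y) (linOp A x) ≤ relDiv ε y x :=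
    calc δ * relDiv ε (linOp A y) (linOp A x)
      _ ≤ δ * (L * relDiv ε y x) :=
          mul_le_mul_of_nonneg_left ((lipschitzLike_iff hA hε hb).1 hL x hx y hy) hδ
      _ = δ * L * relDiv ε y x := (mul_assoc ..).symm
      _ ≤ relDiv ε y x := mul_le_of_le_one_left
          (relDiv_nonneg hε (mem_orthant_of_pos hy) (mem_orthant_of_pos hx)) hδL
  rw [hstep, sub_sub_cancel_left, inner_neg_left, real_inner_smul_left] at hthree
  rw [henergy_u, henergy_y]
  simp only [inner_sub_right] at hthree ⊢
  linarith

theorem exists_tendsto_of_antitone_relDiv (hε : 0 ≤ ε) {S : Set (Vec n)} (hS : S ⊆ orthant n)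
    (hne : S.Nonempty) {x : ℕ → Vec n} (hx : ∀ k i, 0 < x k i)
    (hanti : ∀ u ∈ S, Antitone fun k => relDiv ε u (x k))
    (hcluster : ∀ (a : Vec n) (φ : ℕ → ℕ), StrictMono φ → Tendsto (x ∘ φ) atTop (𝓝 a) → a ∈ S) :
    ∃ a ∈ S, Tendsto x atTop (𝓝 a) := by
  obtain ⟨u, hu⟩ := hne
  obtain ⟨a, -, φ, hφ, hlim⟩ := (isCompact_box _).tendsto_subseq fun k =>
    mem_box_of_relDiv_le_right hε (hS hu) (hx k) (hanti u hu (Nat.zero_le k))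
  have ha := hcluster a φ hφ hlim
  exact ⟨a, ha, tendsto_of_tendsto_relDiv hε (hS ha) hx <|
    (tendsto_iff_tendsto_subseq_of_antitone (hanti a ha) hφ.tendsto_atTop).2
      (tendsto_relDiv_right ε hlim)⟩

theorem tendsto_of_le_add_mul_sub {d f : ℕ → ℝ} {c δ : ℝ} (hδ : 0 < δ) (hd : ∀ k, 0 ≤ d k)
    (hf : ∀ k, c ≤ f k) (h : ∀ k, d (k + 1) ≤ d k + δ * (c - f (k + 1))) :
    Tendsto f atTop (𝓝 c) := by
  have hanti : Antitone d := antitone_nat_of_succ_le fun k => (h k).trans <|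
    add_le_of_nonpos_right (mul_nonpos_of_nonneg_of_nonpos hδ.le (sub_nonpos.2 (hf (k + 1))))
  have hlim := tendsto_atTop_ciInf hanti ⟨0, Set.forall_mem_range.2 hd⟩
  have hdiff : Tendsto (fun k => c + (d k - d (k + 1)) / δ) atTop (𝓝 c) := by
    simpa using ((hlim.sub (hlim.comp (tendsto_add_atTop_nat 1))).div_const δ).const_add c
  refine (tendsto_add_atTop_iff_nat 1).1
    (tendsto_of_tendsto_of_tendsto_of_le_of_le tendsto_const_nhds hdiff (fun k => hf (k + 1)) ?_)
  intro k
  rw [← sub_le_iff_le_add', le_div_iff₀' hδ]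
  linarith [h k]

theorem exists_tendsto_mem_X0_of_step (hA : ∀ i j, 0 ≤ A i j) (hε : 0 ≤ ε) (hb : ∀ i, 0 < b i)
    (hδ : 0 < δ) (hL : LipschitzLike A b ε L) (hδL : δ * L ≤ 1) {x : ℕ → Vec n}
    (hx : ∀ k i, 0 < x k i)
    (hstep : ∀ k, relGrad ε (x (k + 1)) = relGrad ε (x k) - δ • energyGrad A b ε (x k)) :
    ∃ a ∈ X0 A b ε, Tendsto x atTop (𝓝 a) := by
  have hgap {u : Vec n} (hu : u ∈ X0 A b ε) (k : ℕ) : energy A b ε u ≤ energy A b ε (x k) :=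
    (mem_X0_iff.1 hu).2 _ (mem_orthant_of_pos (hx k))
  have hdescent {u : Vec n} (hu : u ∈ X0 A b ε) (k : ℕ) :=
    relDiv_le_of_step hA hε hb hδ.le hL hδL (X0_subset_orthant hu) (hx k) (hx (k + 1)) (hstep k)
  have hanti : ∀ u ∈ X0 A b ε, Antitone fun k => relDiv ε u (x k) := fun u hu =>
    antitone_nat_of_succ_le fun k => (hdescent hu k).trans <|
      add_le_of_nonpos_right (mul_nonpos_of_nonneg_of_nonpos hδ.le (sub_nonpos.2 (hgap hu (k + 1))))
  obtain ⟨u, hu⟩ := X0_nonempty (n := n) hA hε hb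
  have henergy : Tendsto (fun k => energy A b ε (x k)) atTop (𝓝 (energy A b ε u)) :=
    tendsto_of_le_add_mul_sub hδ (fun k => relDiv_nonneg hε (X0_subset_orthant hu)
      (mem_orthant_of_pos (hx k))) (hgap hu) (hdescent hu)
  refine exists_tendsto_of_antitone_relDiv hε X0_subset_orthant ⟨u, hu⟩ hx hanti
    fun a φ hφ hlim => mem_X0_iff.2 ⟨(isClosed_orthant n).mem_of_tendsto hlim <|
      Eventually.of_forall fun k => mem_orthant_of_pos (hx (φ k)), fun z hz => ?_⟩
  have ha : energy A b ε a = energy A b ε u := tendsto_nhds_unique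
    (((continuous_energy A ε hb).tendsto a).comp hlim) (henergy.comp hφ.tendsto_atTop)
  exact ha.trans_le ((mem_X0_iff.1 hu).2 z hz)

end MirrorDescent

/-! ### The iteration -/

section Iteration

variable {m n : ℕ} {A : Matrix (Fin m) (Fin n) ℝ} {b : Vec m} {ε μ δ L : ℝ} {x p : ℕ → Vec n}

theorem intGrad_energy (hA : ∀ i j, 0 ≤ A i j) (hε : 0 ≤ ε) (hb : ∀ i, 0 < b i) {y : Vec n}
    (hy : ∀ j, 0 < y j) : intGrad (energy A b ε) y = energyGrad A b ε y := by
  rw [intGrad, if_pos (mem_interior_orthant.2 hy), (hasGradientAt_energy hA hε hb hy).gradient]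

theorem intGrad_energy_mem_range (hA : ∀ i j, 0 ≤ A i j) (hε : 0 ≤ ε) (hb : ∀ i, 0 < b i)
    (y : Vec n) : intGrad (energy A b ε) y ∈ (ContinuousLinearMap.adjoint (linOp A)).range := by
  by_cases hy : y ∈ interior (orthant n)
  · exact intGrad_energy hA hε hb (mem_interior_orthant.1 hy) ▸ LinearMap.mem_range_self _ _
  · rw [intGrad, if_neg hy]
    exact Submodule.zero_mem _

/-- The vector `∇h(xᵏ) + δ μ pᵏ`: the dual iterate, which moves by `-δ ∇E(xᵏ)`. As in `intGrad`, the
gradient is read as `0` outside of the interior of the orthant. -/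
def dualVar (ε μ δ : ℝ) (x p : Vec n) : Vec n :=
  intGrad (relFun ε) x + (δ * μ) • p

theorem IsStart.dualVar_eq_zero {x₀ p₀ : Vec n} (h : IsStart ε μ δ x₀ p₀) :
    dualVar ε μ δ x₀ p₀ = 0 := by
  rcases h with ⟨rfl, rfl⟩ | ⟨hx₀, h⟩
  · rcases isEmpty_or_nonempty (Fin n) with _ | ⟨⟨i⟩⟩
    · exact Subsingleton.elim _ _
    · have h0 : (0 : Vec n) ∉ interior (orthant n) := fun h0 => (mem_interior_orthant.1 h0 i).false
      rw [dualVar, intGrad, if_neg h0, smul_zero, add_zero]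
  · rw [dualVar, intGrad, if_pos hx₀, h]

theorem IsGenerated.dualVar_succ (hδμ : δ * μ ≠ 0) (h : IsGenerated A b ε μ δ x p) (k : ℕ) :
    dualVar ε μ δ (x (k + 1)) (p (k + 1))
      = dualVar ε μ δ (x k) (p k) - δ • intGrad (energy A b ε) (x k) := by
  rw [dualVar, dualVar, (h k).2, smul_sub, smul_smul, mul_one_div_cancel hδμ, one_smul]
  abel

theorem IsGenerated.dualVar_mem_range (hA : ∀ i j, 0 ≤ A i j) (hε : 0 ≤ ε) (hb : ∀ i, 0 < b i)
    (hδμ : δ * μ ≠ 0) (hstart : IsStart ε μ δ (x 0) (p 0)) (h : IsGenerated A b ε μ δ x p)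
    (k : ℕ) : dualVar ε μ δ (x k) (p k) ∈ (ContinuousLinearMap.adjoint (linOp A)).range := by
  induction k with
  | zero => exact hstart.dualVar_eq_zero ▸ Submodule.zero_mem _
  | succ k ih =>
    rw [h.dualVar_succ hδμ]
    exact Submodule.sub_mem _ ih
      (Submodule.smul_mem _ _ (intGrad_energy_mem_range hA hε hb _))

theorem IsGenerated.succ_pos_and_relGrad_eq_sub (hε : 0 ≤ ε) (h : IsGenerated A b ε μ δ x p)
    (k : ℕ) : (∀ i, 0 < x (k + 1) i) ∧
      relGrad ε (x (k + 1)) = -pbar A b ε μ δ (x k) (p k) - (δ * μ) • ones n := by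
  obtain ⟨z, hz, hgrad, hmin⟩ := exists_forall_subObj_lt μ δ hε (pbar A b ε μ δ (x k) (p k))
  have hxz : x (k + 1) = z := by
    by_contra hne
    exact ((h k).1.2 z (mem_orthant_of_pos hz)).not_gt (hmin _ (h k).1.1 hne)
  exact hxz ▸ ⟨hz, hgrad⟩

theorem IsGenerated.pos_succ (hε : 0 ≤ ε) (h : IsGenerated A b ε μ δ x p) (k : ℕ) (i : Fin n) :
    0 < x (k + 1) i :=
  (h.succ_pos_and_relGrad_eq_sub hε k).1 i

theorem IsGenerated.relGrad_succ (hε : 0 ≤ ε) (hδμ : δ * μ ≠ 0) (h : IsGenerated A b ε μ δ x p)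
    (k : ℕ) : relGrad ε (x (k + 1)) + (δ * μ) • ones n
      = dualVar ε μ δ (x (k + 1)) (p (k + 1)) := by
  rw [(h.succ_pos_and_relGrad_eq_sub hε k).2, h.dualVar_succ hδμ, pbar, dualVar]
  abel

theorem IsGenerated.exists_tendsto_mem_X0 (hA : ∀ i j, 0 ≤ A i j) (hε : 0 ≤ ε) (hb : ∀ i, 0 < b i)
    (hμ : μ ≠ 0) (hδ : 0 < δ) (hL : LipschitzLike A b ε L) (hδL : δ * L ≤ 1)
    (h : IsGenerated A b ε μ δ x p) : ∃ a ∈ X0 A b ε, Tendsto x atTop (𝓝 a) := by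
  have hδμ : δ * μ ≠ 0 := mul_ne_zero hδ.ne' hμ
  have hstep (k : ℕ) : relGrad ε (x (k + 2))
      = relGrad ε (x (k + 1)) - δ • energyGrad A b ε (x (k + 1)) := by
    rw [← intGrad_energy hA hε hb (h.pos_succ hε k), ← add_left_inj ((δ * μ) • ones n),
      h.relGrad_succ hε hδμ (k + 1), h.dualVar_succ hδμ (k + 1), ← h.relGrad_succ hε hδμ k]
    abel
  obtain ⟨a, ha, hlim⟩ :=
    exists_tendsto_mem_X0_of_step hA hε hb hδ hL hδL (h.pos_succ hε) hstep
  exact ⟨a, ha, (tendsto_add_atTop_iff_nat 1).1 hlim⟩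

theorem IsGenerated.relGrad_lim_mem_range (hA : ∀ i j, 0 ≤ A i j) (hε : 0 ≤ ε)
    (hb : ∀ i, 0 < b i) (hδμ : δ * μ ≠ 0) (hstart : IsStart ε μ δ (x 0) (p 0))
    (h : IsGenerated A b ε μ δ x p) {a : Vec n} (ha : ∀ i, 0 < a i) (hlim : Tendsto x atTop (𝓝 a)) :
    relGrad ε a + (δ * μ) • ones n ∈ (ContinuousLinearMap.adjoint (linOp A)).range := by
  refine (Submodule.closed_of_finiteDimensional _).mem_of_tendsto
    ((tendsto_relGrad ε ha ((tendsto_add_atTop_iff_nat 1).2 hlim)).add_const _)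
    (Eventually.of_forall fun k => ?_)
  rw [h.relGrad_succ hε hδμ k]
  exact h.dualVar_mem_range hA hε hb hδμ hstart (k + 1)

end Iteration

end LBreg

end

open LBreg Filter Topology in
theorem mainTheorem7_general {m n : ℕ} (A : Matrix (Fin m) (Fin n) ℝ) (b : Vec m) (ε μ δ : ℝ)
    (hA : ∀ i j, 0 ≤ A i j) (hb : ∀ i, 0 < b i) (hε : 0 ≤ ε) (hμ : μ ≠ 0) (hδ : 0 < δ) :
    (∀ L : ℝ, ‖linOp A‖ ^ 2 ≤ L → (∀ j, ∑ i, A i j ≤ L) → LipschitzLike A b ε L) ∧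
    (∀ q : Vec n, ∃ z ∈ interior (orthant n), ∀ w ∈ orthant n, w ≠ z →
      subObj ε μ δ q z < subObj ε μ δ q w) ∧
    ∃ xhat ∈ X0 A b ε, (∀ z ∈ X0 A b ε, z ≠ xhat → regObj ε μ δ xhat < regObj ε μ δ z) ∧
      ∀ L : ℝ, LipschitzLike A b ε L → δ * L ≤ 1 →
        ∀ x p : ℕ → Vec n, IsStart ε μ δ (x 0) (p 0) → IsGenerated A b ε μ δ x p →
          Tendsto x atTop (𝓝 xhat) ∨ ∃ xs ∈ frontier (orthant n), Tendsto x atTop (𝓝 xs) := by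
  refine ⟨fun L => lipschitzLike_of_le hA hε hb, fun q => ?_, ?_⟩
  · obtain ⟨z, hz, -, hmin⟩ := exists_forall_subObj_lt μ δ hε q
    exact ⟨z, mem_interior_orthant.2 hz, hmin⟩
  obtain ⟨xhat, hxhat, hmin⟩ := exists_forall_regObj_lt μ hε hδ (isClosed_X0 A ε hb)
    (convex_X0 hA hε hb) (X0_nonempty hA hε hb) X0_subset_orthant
  refine ⟨xhat, hxhat, hmin, fun L hL hδL x p hstart hgen => ?_⟩
  obtain ⟨xs, hxs, hlim⟩ := hgen.exists_tendsto_mem_X0 hA hε hb hμ hδ hL hδL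
  by_cases hint : xs ∈ interior (orthant n)
  · rw [mem_interior_orthant] at hint
    have hrange := hgen.relGrad_lim_mem_range hA hε hb (mul_ne_zero hδ.ne' hμ) hstart hint hlim
    have hle := regObj_le_of_mem_range hε hδ hint (X0_subset_orthant hxhat)
      (linOp_eq_of_mem_X0 hA hε hb hxhat hxs) hrange
    obtain rfl : xs = xhat := by_contra fun hne => hle.not_gt (hmin xs hxs hne)
    exact Or.inl hlim
  · refine Or.inr ⟨xs, ?_, hlim⟩
    rw [(isClosed_orthant n).frontier_eq]
    exact ⟨X0_subset_orthant hxs, hint⟩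

theorem mainTheorem7 {m n : ℕ} (A : Matrix (Fin m) (Fin n) ℝ) (b : LBreg.Vec m) (ε μ δ : ℝ)
    (hA : ∀ i j, 0 ≤ A i j) (hsurj : Function.Surjective (LBreg.linOp A))
    (hb : ∀ i, 0 < b i) (hε : 0 ≤ ε) (hμ : 0 < μ) (hδ : 0 < δ) :
    (∀ L : ℝ, 0 < L → ‖LBreg.linOp A‖ ^ 2 ≤ L → (∀ j, ∑ i, A i j ≤ L) →
      LBreg.LipschitzLike A b ε L) ∧
    (∀ q : LBreg.Vec n, ∃ z ∈ interior (LBreg.orthant n), ∀ w ∈ LBreg.orthant n, w ≠ z →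
      LBreg.subObj ε μ δ q z < LBreg.subObj ε μ δ q w) ∧
    ∃ xhat ∈ LBreg.X0 A b ε,
      (∀ z ∈ LBreg.X0 A b ε, z ≠ xhat → LBreg.regObj ε μ δ xhat < LBreg.regObj ε μ δ z) ∧
      ∀ L : ℝ, 0 < L → LBreg.LipschitzLike A b ε L →
        (∃ ω ∈ Set.Ioo 0 (1 + LBreg.symCoeff n ε), δ < (1 + LBreg.symCoeff n ε - ω) / L) →
        ∀ x p : ℕ → LBreg.Vec n, LBreg.IsStart ε μ δ (x 0) (p 0) →
          LBreg.IsGenerated A b ε μ δ x p →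
          Filter.Tendsto x Filter.atTop (nhds xhat) ∨
            ∃ xs ∈ frontier (LBreg.orthant n), Filter.Tendsto x Filter.atTop (nhds xs) := by
  obtain ⟨hLC, hsub, xhat, hxhat, hmin, hconv⟩ :=
    mainTheorem7_general A b ε μ δ hA hb hε hμ.ne' hδ
  exact ⟨fun L _ => hLC L, hsub, xhat, hxhat, hmin, fun L hL0 hL ⟨_, hω, hδω⟩ =>
    hconv L hL (LBreg.mul_le_one_of_lt_one_add_symCoeff_sub_div hε hL0 hω.1.le hδω)⟩
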